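/- Let $K$ be an infinite field, let $R=K[x,y,z]$ with the standard grading, and let $\mathfrak m=(x,y,z)$. For a homogeneous ideal $I\subset R$ the socle of $R/I$ is the graded ideal $\operatorname{soc}(R/I)=\{a\in R/I : \mathfrak m a=0\}$. There is a nonempty Zariski open set of quadruples $(L_1,L_2,L_3,L_4)$ of linear forms in $R$ such that for every quadruple in it (that is, for general $L_1,\dots,L_4$) the following holds for every integer $k\ge 1$ such that $\operatorname{char}K=0$ or $\operatorname{char}K>3k-3$. Put $I=(L_1^k,L_2^k,L_3^k,L_4^k)$. Then $[\operatorname{soc}(R/I)]_{2k-2}\neq 0$, and $[\operatorname{soc}(R/I)]_d=0$ for every $d\notin\{2k-3,\,2k-2\}$. In other words, the socle of $R/I$ occurs in degree $2k-2$ and possibly in degree $2k-3$, and in no other degree. -/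

import Mathlib

open MvPolynomial

noncomputable section

/-- The linear form `a 0 * x + a 1 * y + a 2 * z` of `R = K[x, y, z]`. -/
def linForm {K : Type*} [Field K] (a : Fin 3 → K) : MvPolynomial (Fin 3) K :=
  ∑ j, C (a j) * X j

/-- A property `P` of `r`-tuples of linear forms of `K[x, y, z]` holds for general linear forms:
it holds on some basic open set `{g ≠ 0}`, with `g` a nonzero polynomial in the `3 r` coefficients.
Over an infinite field such a set is nonempty, and every nonempty Zariski open set contains one, so
this says that `P` holds on a nonempty Zariski open subset of the space of `r`-tuples. -/
def ForGeneralLinearForms (K : Type*) [Field K] (r : ℕ)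
    (P : (Fin r → MvPolynomial (Fin 3) K) → Prop) : Prop :=
  ∃ g : MvPolynomial (Fin r × Fin 3) K, g ≠ 0 ∧
    ∀ a : Fin r → Fin 3 → K, eval (fun ij => a ij.1 ij.2) g ≠ 0 → P (fun i => linForm (a i))

/-- The ideal `(L_1 ^ k, …, L_r ^ k)`. -/
def uniformPowerIdeal {K : Type*} [Field K] {r : ℕ} (L : Fin r → MvPolynomial (Fin 3) K) (k : ℕ) :
    Ideal (MvPolynomial (Fin 3) K) :=
  Ideal.span (Set.range fun i => L i ^ k)

/-- The graded component `[R/I]_d`: the classes of the forms of degree `d`. -/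
def quotientComponent {K : Type*} [Field K] (I : Ideal (MvPolynomial (Fin 3) K)) (d : ℕ) :
    Submodule K (MvPolynomial (Fin 3) K ⧸ I) :=
  (homogeneousSubmodule (Fin 3) K d).map (Ideal.Quotient.mkₐ K I).toLinearMap

/-- The socle `0 : 𝔪` of `R/I`, that is, the elements annihilated by the homogeneous maximal
ideal `𝔪 = (x, y, z)`. -/
def quotientSocle {K : Type*} [Field K] (I : Ideal (MvPolynomial (Fin 3) K)) :
    Ideal (MvPolynomial (Fin 3) K ⧸ I) where
  carrier := {a | ∀ m ∈ Ideal.span (Set.range (X : Fin 3 → MvPolynomial (Fin 3) K)),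
    Ideal.Quotient.mk I m * a = 0}
  add_mem' ha hb m hm := by rw [mul_add, ha m hm, hb m hm, add_zero]
  zero_mem' m _ := mul_zero _
  smul_mem' c a ha m hm := by rw [smul_eq_mul, mul_left_comm, ha m hm, mul_zero]

/-- The graded component of degree `d` of the socle of `R/I`. -/
def socleComponent {K : Type*} [Field K] (I : Ideal (MvPolynomial (Fin 3) K)) (d : ℕ) :
    Submodule K (MvPolynomial (Fin 3) K ⧸ I) :=
  (quotientSocle I).restrictScalars K ⊓ quotientComponent I d

end

/-! A linear change of coordinates reduces four general forms to `x`, `y`, `z`, `ℓ = x + y + z` up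
to scalars. Put `J = (x^k, y^k, z^k)` and `A = R/J`, so that `R/I = A/ℓ^k A`. The characteristic
hypothesis makes the `𝔰𝔩₂`-action on `A` give the strong Lefschetz property: `ℓ^(3k-3-2i)` is
injective on `A_i` (`mem_varPowerIdeal_of_sumX_pow_mul_mem`).

Let `k ≥ 2`. By duality of dimensions `ℓ^(k+1)` maps `A_(k-2)` onto `A_(2k-1)`, so `R/I` vanishes
from degree `2k-1` on. Since `dim A_(k-2) < dim A_(k-1) = dim A_(2k-2)`, it is nonzero in degree
`2k-2`, which is therefore all socle.

If `f` represents a socle element of degree at most `2k-4`, write `X_j f = ℓ^k u_j` in `A`.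
Injectivity turns `ℓ^k (X_i u_j - X_j u_i) = 0` into `X_i u_j = X_j u_i`, already in `R` because the
degrees are below `k`. Hence `u_j = X_j v`, and `f - ℓ^k v` lies in the socle of `A`, which dies in
`R/I`; so `f ∈ I` (`mem_fourPowerIdeal_of_X_mul_mem`). -/

/-! ### The `𝔰𝔩₂`-action and the strong Lefschetz property -/

noncomputable section

/-- The monomial complete intersection ideal `(x ^ k, y ^ k, z ^ k)`. -/
def varPowerIdeal (K : Type*) [Field K] (k : ℕ) : Ideal (MvPolynomial (Fin 3) K) :=
  Ideal.span (Set.range fun j => X j ^ k)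

/-- The linear form `x + y + z`. -/
def sumX (K : Type*) [Field K] : MvPolynomial (Fin 3) K := ∑ j, X j

/-- The lowering operator of the `𝔰𝔩₂`-action on `K[x, y, z] / (x ^ k, y ^ k, z ^ k)` whose raising
operator is multiplication by `x + y + z`. -/
def lowering {K : Type*} [Field K] (k : ℕ) (f : MvPolynomial (Fin 3) K) :
    MvPolynomial (Fin 3) K :=
  ∑ j, (((k : MvPolynomial (Fin 3) K) - 1) * pderiv j f - X j * pderiv j (pderiv j f))

section

variable {K : Type*} [Field K]

lemma mem_varPowerIdeal {k : ℕ} {f : MvPolynomial (Fin 3) K} :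
    f ∈ varPowerIdeal K k ↔ ∀ m ∈ f.support, ∃ j, k ≤ m j := by
  have h : (Set.range fun j : Fin 3 => (X j ^ k : MvPolynomial (Fin 3) K)) =
      (fun s => monomial s (1 : K)) '' (Set.range fun j : Fin 3 => Finsupp.single j k) := by
    rw [← Set.range_comp]
    congr 1
    funext j
    simp [X_pow_eq_monomial]
  rw [varPowerIdeal, h, mem_ideal_span_monomial_image]
  simp

lemma lowering_add (k : ℕ) (f g : MvPolynomial (Fin 3) K) :
    lowering k (f + g) = lowering k f + lowering k g := by
  simp only [lowering, map_add, ← Finset.sum_add_distrib]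
  exact Finset.sum_congr rfl fun j _ => by ring

lemma lowering_sum (k : ℕ) {ι : Type*} (s : Finset ι) (f : ι → MvPolynomial (Fin 3) K) :
    lowering k (∑ i ∈ s, f i) = ∑ i ∈ s, lowering k (f i) :=
  map_sum (AddMonoidHom.mk' (lowering k) (lowering_add k)) f s

lemma pderiv_sumX (j : Fin 3) : pderiv j (sumX K) = 1 := by
  simp [sumX, map_sum, pderiv_X, Pi.single_apply]

lemma isHomogeneous_sumX : (sumX K).IsHomogeneous 1 :=
  IsHomogeneous.sum _ _ _ fun j _ => isHomogeneous_X K j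

/-- The commutator of lowering and raising is the weight operator: the product rule leaves `3(k-1)f
- 2 ∑ X_j ∂_j f`, and Euler's identity evaluates the sum. -/
lemma lowering_sumX_mul {k i : ℕ} {f : MvPolynomial (Fin 3) K} (hf : f.IsHomogeneous i) :
    lowering k (sumX K * f) =
      sumX K * lowering k f + (3 * ((k : MvPolynomial (Fin 3) K) - 1) - 2 * i) * f := by
  have e := hf.sum_X_mul_pderiv
  rw [nsmul_eq_mul] at e
  have h : ∀ j : Fin 3, pderiv j (sumX K * f) = f + sumX K * pderiv j f := fun j => by
    rw [pderiv_mul, pderiv_sumX, one_mul]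
  have h' : ∀ j : Fin 3, pderiv j (sumX K * pderiv j f) =
      pderiv j f + sumX K * pderiv j (pderiv j f) := fun j => by
    rw [pderiv_mul, pderiv_sumX, one_mul]
  simp only [lowering, h, map_add, h', Fin.sum_univ_three] at e ⊢
  linear_combination -2 * e

/-- Iterating the commutator adds the weights `w - 2s` for `0 ≤ s ≤ m`, where `w = 3(k-1) - 2i`;
their sum is `(m+1)(w-m)`. -/
lemma lowering_sumX_pow_mul {k i : ℕ} {f : MvPolynomial (Fin 3) K} (hf : f.IsHomogeneous i)
    (m : ℕ) :
    lowering k (sumX K ^ (m + 1) * f) = sumX K ^ (m + 1) * lowering k f +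
      (m + 1) * (3 * ((k : MvPolynomial (Fin 3) K) - 1) - 2 * i - m) * (sumX K ^ m * f) := by
  induction m with
  | zero => simpa using lowering_sumX_mul (k := k) hf
  | succ m ih =>
    have h : (sumX K ^ (m + 1) * f).IsHomogeneous (m + 1 + i) := by
      simpa using (isHomogeneous_sumX.pow (m + 1)).mul hf
    rw [pow_succ' _ (m + 1), mul_assoc, lowering_sumX_mul h, ih]
    push_cast
    ring

/-- The operator sends `X_j^m` to `m(k-m) X_j^(m-1)`, which vanishes for `m = k`. With a coefficient
`c` in front, the only terms not divisible by `X_j^k` cancel for the same reason, so the operator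
descends to `A`. -/
lemma lowering_mem {k : ℕ} (hk : 1 ≤ k) {f : MvPolynomial (Fin 3) K}
    (hf : f ∈ varPowerIdeal K k) : lowering k f ∈ varPowerIdeal K k := by
  obtain ⟨c, rfl⟩ := (Ideal.mem_span_range_iff_exists_fun).1 hf
  rw [lowering_sum]
  refine Ideal.sum_mem _ fun i _ => Ideal.sum_mem _ fun j _ => ?_
  suffices h : (X i ^ k : MvPolynomial (Fin 3) K) ∣ ((k : MvPolynomial (Fin 3) K) - 1) *
      pderiv j (c i * X i ^ k) - X j * pderiv j (pderiv j (c i * X i ^ k)) from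
    Ideal.mem_of_dvd _ h (Ideal.subset_span ⟨i, rfl⟩)
  obtain ⟨n, rfl⟩ := Nat.exists_eq_add_of_le' hk
  by_cases hij : i = j
  · subst hij
    have h1 : ∀ n : ℕ, pderiv i (X i ^ (n + 1) : MvPolynomial (Fin 3) K) =
        ((n : MvPolynomial (Fin 3) K) + 1) * X i ^ n := by
      intro n
      simp
    have h2 : X i * pderiv i (X i ^ n : MvPolynomial (Fin 3) K) =
        (n : MvPolynomial (Fin 3) K) * X i ^ n := by
      cases n with
      | zero => simp
      | succ n => rw [h1]; push_cast; ring
    have h3 : pderiv i ((n : MvPolynomial (Fin 3) K) + 1) = 0 := by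
      simp
    refine ⟨(n : MvPolynomial (Fin 3) K) * pderiv i (c i) - X i * pderiv i (pderiv i (c i))
      - 2 * ((n : MvPolynomial (Fin 3) K) + 1) * pderiv i (c i), ?_⟩
    simp only [pderiv_mul, h1, map_add, h3]
    push_cast
    linear_combination (-(n : MvPolynomial (Fin 3) K) - 1) * c i * h2
  · have h1 : ∀ n : ℕ, pderiv j (X i ^ n : MvPolynomial (Fin 3) K) = 0 := by
      intro n
      simp [pderiv_X_of_ne hij]
    simp only [pderiv_mul, h1, mul_zero, add_zero]
    exact ⟨(((n + 1 : ℕ) : MvPolynomial (Fin 3) K) - 1) * pderiv j (c i)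
      - X j * pderiv j (pderiv j (c i)), by ring⟩

lemma lowering_isHomogeneous_zero {k : ℕ} {f : MvPolynomial (Fin 3) K} (hf : f.IsHomogeneous 0) :
    lowering k f = 0 := by
  rw [← totalDegree_zero_iff_isHomogeneous, totalDegree_eq_zero_iff_eq_C] at hf
  rw [hf]
  simp [lowering]

lemma IsHomogeneous.lowering {k i : ℕ} {f : MvPolynomial (Fin 3) K}
    (hf : f.IsHomogeneous (i + 1)) : (lowering k f).IsHomogeneous i := by
  refine IsHomogeneous.sum _ _ _ fun j _ => ?_
  have h1 : (pderiv j f).IsHomogeneous i := hf.pderiv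
  refine IsHomogeneous.sub ?_ ?_
  · simpa using (h1.C_mul ((k : K) - 1))
  -- For `i = 0` the degree of the second derivative would be the truncated `0 - 1 = 0`, one too
  -- many after multiplying by `X j`; but that derivative is zero.
  · cases i with
    | zero =>
      rw [← totalDegree_zero_iff_isHomogeneous, totalDegree_eq_zero_iff_eq_C] at h1
      rw [h1, pderiv_C, mul_zero]
      exact isHomogeneous_zero _ _ _
    | succ i =>
      have := (isHomogeneous_X K j).mul (h1.pderiv (i := j))
      rwa [Nat.add_sub_cancel, add_comm 1] at this

/-- A primitive vector of weight `-n` is not killed by the `n`-th power of the raising operator. -/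
lemma mem_of_lowering_mem {k i n : ℕ} (hk : 1 ≤ k)
    (hK : ∀ j : ℕ, 0 < j → j ≤ 3 * k - 3 → (j : K) ≠ 0) (hn : 2 * i + n + 3 = 3 * k)
    {f : MvPolynomial (Fin 3) K} (hf : f.IsHomogeneous i) (hF : lowering k f ∈ varPowerIdeal K k)
    {m : ℕ} (hm : m ≤ n) (h : sumX K ^ m * f ∈ varPowerIdeal K k) : f ∈ varPowerIdeal K k := by
  induction m with
  | zero => simpa using h
  | succ m ih =>
    refine ih (by omega) ?_
    obtain ⟨r, rfl⟩ := Nat.exists_eq_add_of_le hm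
    have h1 := lowering_mem hk h
    rw [lowering_sumX_pow_mul hf] at h1
    have h2 := (Ideal.add_mem_iff_right _ (Ideal.mul_mem_left _ _ hF)).1 h1
    -- Here `3(k-1) - 2i = n = m + 1 + r`, so the coefficient is `(m+1)(n-m) = (m+1)(r+1)`, with
    -- both factors between `1` and `3k-3`.
    have e : ((m : MvPolynomial (Fin 3) K) + 1) *
        (3 * ((k : MvPolynomial (Fin 3) K) - 1) - 2 * (i : MvPolynomial (Fin 3) K) -
          (m : MvPolynomial (Fin 3) K)) =
        C (((m + 1 : ℕ) : K) * ((r + 1 : ℕ) : K)) := by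
      have := congrArg (Nat.cast : ℕ → MvPolynomial (Fin 3) K) hn
      push_cast at this
      simp only [map_mul, map_natCast]
      push_cast
      linear_combination (-(m : MvPolynomial (Fin 3) K) - 1) * this
    rw [e] at h2
    have h3 := Ideal.mul_mem_left _ (C (((m + 1 : ℕ) : K) * ((r + 1 : ℕ) : K))⁻¹) h2
    rwa [← mul_assoc, ← C_mul, inv_mul_cancel₀, C_1, one_mul] at h3
    exact mul_ne_zero (hK _ (by omega) (by omega)) (hK _ (by omega) (by omega))

/-- Strong Lefschetz property of `K[x, y, z] / (x ^ k, y ^ k, z ^ k)` with respect to `x + y + z`: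
multiplication from degree `i` to the complementary degree is injective. -/
lemma mem_varPowerIdeal_of_sumX_pow_mul_mem {k i n : ℕ} (hk : 1 ≤ k)
    (hK : ∀ j : ℕ, 0 < j → j ≤ 3 * k - 3 → (j : K) ≠ 0) (hn : 2 * i + n + 3 = 3 * k)
    {f : MvPolynomial (Fin 3) K} (hf : f.IsHomogeneous i)
    (h : sumX K ^ n * f ∈ varPowerIdeal K k) : f ∈ varPowerIdeal K k := by
  induction i generalizing n f with
  | zero =>
    refine mem_of_lowering_mem hk hK hn hf ?_ le_rfl h
    rw [lowering_isHomogeneous_zero hf]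
    exact Ideal.zero_mem _
  | succ i ih =>
    refine mem_of_lowering_mem hk hK hn hf ?_ le_rfl h
    -- Lowering `ℓ^(n+1) f ∈ J` gives `ℓ^(n+1)` times the lowered `f`, plus a multiple of `ℓ^n f ∈
    -- J`. So the lowered form satisfies the induction hypothesis, and `f` is primitive modulo `J`.
    refine ih (n := n + 2) (by omega) (IsHomogeneous.lowering hf) ?_
    have h1 : sumX K ^ (n + 1) * f ∈ varPowerIdeal K k := by
      rw [pow_succ', mul_assoc]
      exact Ideal.mul_mem_left _ _ h
    have h2 := lowering_mem hk h1
    rw [lowering_sumX_pow_mul hf] at h2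
    have h3 := (Ideal.add_mem_iff_left _
      (Ideal.mul_mem_left _ _ h)).1 h2
    rw [pow_succ', mul_assoc]
    exact Ideal.mul_mem_left _ _ h3

end
end

/-! ### Adding `(x + y + z)^k`: dimensions and socle -/

noncomputable section

/-- The ideal `(x ^ k, y ^ k, z ^ k, (x + y + z) ^ k)`. -/
def fourPowerIdeal (K : Type*) [Field K] (k : ℕ) : Ideal (MvPolynomial (Fin 3) K) :=
  Ideal.span {sumX K ^ k} ⊔ varPowerIdeal K k

/-- The exponents of degree `d` whose monomials form a basis of
`[K[x, y, z] / (x ^ k, y ^ k, z ^ k)]_d`. -/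
def boxExponents (k d : ℕ) : Set (Fin 3 →₀ ℕ) :=
  {m | m.degree = d ∧ ∀ j, m j < k}

lemma degree_fin_three (m : Fin 3 →₀ ℕ) : m.degree = m 0 + m 1 + m 2 := by
  rw [Finsupp.degree_eq_sum, Fin.sum_univ_three]

lemma finite_boxExponents (k d : ℕ) : (boxExponents k d).Finite :=
  (Set.finite_Iic (Finsupp.equivFunOnFinite.symm fun _ : Fin 3 => k)).subset
    fun _ hm j => (hm.2 j).le

/-- The symmetry `m ↦ (k-1, k-1, k-1) - m` of the box, a numerical form of the Gorenstein duality of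
`A`. -/
lemma ncard_boxExponents_compl {k d e : ℕ} (h : d + e + 3 = 3 * k) :
    (boxExponents k d).ncard = (boxExponents k e).ncard := by
  let c : Fin 3 →₀ ℕ := Finsupp.equivFunOnFinite.symm fun _ => k - 1
  have hc : ∀ (m : Fin 3 →₀ ℕ) j, (c - m) j = k - 1 - m j := fun m j => by simp [c]
  have hm : ∀ d e, d + e + 3 = 3 * k → ∀ m ∈ boxExponents k d, c - m ∈ boxExponents k e := by
    rintro d e h m ⟨hd, hm⟩
    have := hm 0; have := hm 1; have := hm 2
    rw [degree_fin_three] at hd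
    refine ⟨?_, fun j => ?_⟩
    · rw [degree_fin_three, hc, hc, hc]; omega
    · rw [hc]; omega
  have hi : ∀ d, ∀ m ∈ boxExponents k d, c - (c - m) = m := by
    rintro d m ⟨-, hm⟩
    ext j
    have := hm j
    rw [hc, hc]; omega
  refine Set.ncard_congr (fun m _ => c - m) (hm d e h) (fun m m' hd hd' he => ?_)
    fun m hd => ⟨c - m, hm e d (by omega) m hd, hi e m hd⟩
  rw [← hi d m hd, ← hi d m' hd']
  exact congrArg (c - ·) he

/-- Multiplication by `x` embeds the smaller set, the box bound being automatic in degrees below `n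
+ 2`, and misses `y^(n+1)`. -/
lemma ncard_boxExponents_lt (n : ℕ) :
    (boxExponents (n + 2) n).ncard < (boxExponents (n + 2) (n + 1)).ncard := by
  have hinj : Function.Injective fun m : Fin 3 →₀ ℕ => m + Finsupp.single 0 1 :=
    add_left_injective _
  rw [← Set.ncard_image_of_injective _ hinj]
  refine Set.ncard_lt_ncard ((Set.ssubset_iff_of_subset ?_).2
    ⟨Finsupp.single 1 (n + 1), ?_, ?_⟩) (finite_boxExponents _ _)
  · rintro _ ⟨m, ⟨hd, -⟩, rfl⟩
    rw [degree_fin_three] at hd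
    refine ⟨by simp [degree_fin_three]; omega, fun j => ?_⟩
    have : (m + Finsupp.single 0 1 : Fin 3 →₀ ℕ) j ≤ m j + 1 := by
      simp only [Finsupp.add_apply, Finsupp.single_apply]
      split_ifs <;> omega
    refine this.trans_lt ?_
    fin_cases j <;> simp <;> omega
  · refine ⟨by simp, fun j => ?_⟩
    simp only [Finsupp.single_apply]
    split_ifs <;> omega
  · rintro ⟨m, -, h⟩
    have := DFunLike.congr_fun h 0
    simp at this

section

variable {K : Type*} [Field K]

lemma finrank_map_of_injOn {V W : Type*} [AddCommGroup V] [Module K V] [AddCommGroup W]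
    [Module K W] (f : V →ₗ[K] W) (S : Submodule K V) (h : ∀ x ∈ S, f x = 0 → x = 0) :
    Module.finrank K (S.map f) = Module.finrank K S := by
  refine (LinearEquiv.ofBijective (f.submoduleMap S)
    ⟨?_, f.submoduleMap_surjective S⟩).finrank_eq.symm
  rw [← LinearMap.ker_eq_bot, LinearMap.ker_eq_bot']
  exact fun x hx => Subtype.ext (h x x.2 (congrArg Subtype.val hx))

lemma quotientComponent_varPowerIdeal (k d : ℕ) :
    quotientComponent (varPowerIdeal K k) d =
      (restrictSupport K (boxExponents k d)).map
        (Ideal.Quotient.mkₐ K (varPowerIdeal K k)).toLinearMap := by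
  apply le_antisymm
  · rintro _ ⟨f, hf, rfl⟩
    rw [f.as_sum, map_sum]
    refine Submodule.sum_mem _ fun m hm => ?_
    by_cases hb : ∀ j, m j < k
    · refine Submodule.mem_map_of_mem ((monomial_mem_restrictSupport K).2 (Or.inl ⟨?_, hb⟩))
      by_contra hne
      exact (mem_support_iff.1 hm) (IsHomogeneous.coeff_eq_zero hf hne)
    · have : monomial m (coeff m f) ∈ varPowerIdeal K k := by
        rw [mem_varPowerIdeal]
        intro m' hm'
        rw [Finset.mem_singleton.1 (support_monomial_subset hm')]
        push Not at hb
        exact hb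
      have h0 : (Ideal.Quotient.mkₐ K (varPowerIdeal K k)).toLinearMap
          (monomial m (coeff m f)) = 0 := Ideal.Quotient.eq_zero_iff_mem.2 this
      rw [h0]
      exact Submodule.zero_mem _
  · refine Submodule.map_mono ?_
    rw [homogeneousSubmodule_eq_finsupp_supported]
    exact restrictSupport_mono K fun m hm => hm.1

lemma eq_zero_of_mem_varPowerIdeal {k : ℕ} {f : MvPolynomial (Fin 3) K}
    (hf : f ∈ varPowerIdeal K k) (h : ∀ m ∈ f.support, ∀ j, m j < k) : f = 0 := by
  rw [← support_eq_empty, Finset.eq_empty_iff_forall_notMem]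
  intro m hm
  obtain ⟨j, hj⟩ := mem_varPowerIdeal.1 hf m hm
  exact absurd (h m hm j) (by omega)

lemma eq_zero_of_isHomogeneous_of_mem {k d : ℕ} (hd : d < k) {f : MvPolynomial (Fin 3) K}
    (hf : f.IsHomogeneous d) (h : f ∈ varPowerIdeal K k) : f = 0 := by
  refine eq_zero_of_mem_varPowerIdeal h fun m hm j => ?_
  have : m.degree = d := by
    by_contra hne
    exact (mem_support_iff.1 hm) (hf.coeff_eq_zero hne)
  exact (Finsupp.le_degree j m).trans_lt (by omega)

lemma finrank_quotientComponent_varPowerIdeal (k d : ℕ) :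
    Module.finrank K (quotientComponent (varPowerIdeal K k) d) = (boxExponents k d).ncard := by
  rw [quotientComponent_varPowerIdeal, finrank_map_of_injOn,
    Module.finrank_eq_nat_card_basis (basisRestrictSupport K _)]
  · rfl
  · exact fun f hf h => eq_zero_of_mem_varPowerIdeal (Ideal.Quotient.eq_zero_iff_mem.1 h)
      fun m hm => (hf hm).2

instance (k d : ℕ) : FiniteDimensional K (quotientComponent (varPowerIdeal K k) d) := by
  rw [quotientComponent_varPowerIdeal]
  have := (finite_boxExponents k d).to_subtype
  have := Module.Finite.of_basis (basisRestrictSupport K (boxExponents k d))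
  infer_instance

/-- Multiplication by `(x + y + z) ^ e` on `K[x, y, z] / (x ^ k, y ^ k, z ^ k)`. -/
def mulSumXPow (K : Type*) [Field K] (k e : ℕ) :
    (MvPolynomial (Fin 3) K ⧸ varPowerIdeal K k) →ₗ[K]
      (MvPolynomial (Fin 3) K ⧸ varPowerIdeal K k) :=
  LinearMap.mulLeft K (Ideal.Quotient.mk _ (sumX K ^ e))

lemma mulSumXPow_mk (k e : ℕ) (f : MvPolynomial (Fin 3) K) :
    mulSumXPow K k e (Ideal.Quotient.mk _ f) = Ideal.Quotient.mk _ (sumX K ^ e * f) := by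
  rw [mulSumXPow, LinearMap.mulLeft_apply, map_mul]

lemma isHomogeneous_sumX_pow_mul {d : ℕ} (e : ℕ) {f : MvPolynomial (Fin 3) K}
    (hf : f.IsHomogeneous d) : (sumX K ^ e * f).IsHomogeneous (e + d) := by
  simpa using (isHomogeneous_sumX.pow e).mul hf

lemma mem_fourPowerIdeal {k : ℕ} {f : MvPolynomial (Fin 3) K} :
    f ∈ fourPowerIdeal K k ↔ ∃ u, f - sumX K ^ k * u ∈ varPowerIdeal K k := by
  rw [fourPowerIdeal, Ideal.mem_span_singleton_sup]
  constructor
  · rintro ⟨u, b, hb, rfl⟩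
    exact ⟨u, by convert hb using 1; ring⟩
  · rintro ⟨u, hu⟩
    exact ⟨u, _, hu, by ring⟩

/-- With `k = n + 2`, the degrees `n` and `2n + 3` are complementary in `A`, so the injective map
`ℓ^(n+3)` between them is onto by equality of dimensions. -/
lemma mem_fourPowerIdeal_of_isHomogeneous {n : ℕ}
    (hK : ∀ j : ℕ, 0 < j → j ≤ 3 * (n + 2) - 3 → (j : K) ≠ 0) {f : MvPolynomial (Fin 3) K}
    (hf : f.IsHomogeneous (2 * n + 3)) : f ∈ fourPowerIdeal K (n + 2) := by
  have hle : (quotientComponent (varPowerIdeal K (n + 2)) n).map (mulSumXPow K (n + 2) (n + 3)) ≤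
      quotientComponent (varPowerIdeal K (n + 2)) (2 * n + 3) := by
    rintro _ ⟨_, ⟨u, hu, rfl⟩, rfl⟩
    refine ⟨sumX K ^ (n + 3) * u, ?_, (mulSumXPow_mk _ _ _).symm⟩
    have := isHomogeneous_sumX_pow_mul (n + 3) hu
    rwa [show n + 3 + n = 2 * n + 3 by ring] at this
  have heq := Submodule.eq_of_le_of_finrank_eq hle (by
    rw [finrank_map_of_injOn, finrank_quotientComponent_varPowerIdeal,
      finrank_quotientComponent_varPowerIdeal,
      ncard_boxExponents_compl (d := n) (e := 2 * n + 3) (by omega)]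
    rintro _ ⟨u, hu, rfl⟩ h
    have h' := (mulSumXPow_mk _ _ _).symm.trans h
    exact Ideal.Quotient.eq_zero_iff_mem.2 (mem_varPowerIdeal_of_sumX_pow_mul_mem (by omega) hK
      (by omega) hu (Ideal.Quotient.eq_zero_iff_mem.1 h')))
  have hmem : Ideal.Quotient.mk (varPowerIdeal K (n + 2)) f ∈
      quotientComponent (varPowerIdeal K (n + 2)) (2 * n + 3) := ⟨f, hf, rfl⟩
  rw [← heq] at hmem
  obtain ⟨_, ⟨u, -, rfl⟩, h⟩ := hmem
  have h' := (mulSumXPow_mk _ _ _).symm.trans h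
  rw [Ideal.Quotient.eq] at h'
  -- The Lefschetz exponent is `k + 1`; the surplus factor `ℓ` goes into the cofactor.
  refine mem_fourPowerIdeal.2 ⟨sumX K * u, ?_⟩
  rw [← neg_mem_iff]
  convert h' using 1
  ring

lemma mem_fourPowerIdeal_of_isHomogeneous_of_le {n d : ℕ}
    (hK : ∀ j : ℕ, 0 < j → j ≤ 3 * (n + 2) - 3 → (j : K) ≠ 0) (hd : 2 * n + 3 ≤ d)
    {f : MvPolynomial (Fin 3) K} (hf : f.IsHomogeneous d) : f ∈ fourPowerIdeal K (n + 2) := by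
  induction d, hd using Nat.le_induction generalizing f with
  | base => exact mem_fourPowerIdeal_of_isHomogeneous hK hf
  | succ d hd ih =>
    rw [f.as_sum]
    refine Ideal.sum_mem _ fun m hm => ?_
    have hdeg : m.degree = d + 1 := by
      by_contra hne
      exact (mem_support_iff.1 hm) (hf.coeff_eq_zero hne)
    obtain ⟨j, hj⟩ : ∃ j, m j ≠ 0 := by
      by_contra! h0
      rw [degree_fin_three, h0, h0, h0] at hdeg
      omega
    have hm' : m = m - Finsupp.single j 1 + Finsupp.single j 1 :=
      (tsub_add_cancel_of_le (Finsupp.single_le_iff.2 (by omega))).symm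
    rw [hm', map_add, Finsupp.degree_single] at hdeg
    rw [hm', monomial_add_single]
    exact Ideal.mul_mem_right _ _ (ih (isHomogeneous_monomial _ (by omega)))

lemma homogeneousComponent_mem_varPowerIdeal {k : ℕ} (d : ℕ) {f : MvPolynomial (Fin 3) K}
    (hf : f ∈ varPowerIdeal K k) : homogeneousComponent d f ∈ varPowerIdeal K k := by
  rw [mem_varPowerIdeal] at hf ⊢
  intro m hm
  rw [support_homogeneousComponent] at hm
  exact hf m (Finset.mem_filter.1 hm).1

lemma homogeneousComponent_sumX_pow_mul (e d : ℕ) (f : MvPolynomial (Fin 3) K) :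
    homogeneousComponent (e + d) (sumX K ^ e * f) = sumX K ^ e * homogeneousComponent d f := by
  have h : ∀ i, homogeneousComponent (e + d) (sumX K ^ e * homogeneousComponent i f) =
      if i = d then sumX K ^ e * homogeneousComponent d f else 0 := fun i => by
    rw [homogeneousComponent_of_mem
      (isHomogeneous_sumX_pow_mul e (homogeneousComponent_isHomogeneous i f))]
    by_cases h : i = d
    · simp [h]
    · rw [if_neg (by omega), if_neg h]
  conv_lhs => rw [← sum_homogeneousComponent f, Finset.mul_sum, map_sum]
  simp only [h, Finset.sum_ite_eq', Finset.mem_range]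
  split_ifs with hd
  · rfl
  · rw [homogeneousComponent_eq_zero _ _ (by omega), mul_zero]

lemma homogeneousComponent_sumX_pow_mul_of_lt {e d : ℕ} (h : d < e)
    (f : MvPolynomial (Fin 3) K) : homogeneousComponent d (sumX K ^ e * f) = 0 := by
  conv_lhs => rw [← sum_homogeneousComponent f, Finset.mul_sum, map_sum]
  refine Finset.sum_eq_zero fun i _ => ?_
  rw [homogeneousComponent_of_mem
      (isHomogeneous_sumX_pow_mul e (homogeneousComponent_isHomogeneous i f)),
    if_neg (by omega)]

/-- `J` is homogeneous, so any cofactor of `ℓ^k` may be replaced by its component of degree `d`. -/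
lemma exists_isHomogeneous_of_mem_fourPowerIdeal {k d : ℕ} {f : MvPolynomial (Fin 3) K}
    (hf : f.IsHomogeneous (k + d)) (h : f ∈ fourPowerIdeal K k) :
    ∃ u : MvPolynomial (Fin 3) K, u.IsHomogeneous d ∧ f - sumX K ^ k * u ∈ varPowerIdeal K k := by
  obtain ⟨u, hu⟩ := mem_fourPowerIdeal.1 h
  refine ⟨homogeneousComponent d u, homogeneousComponent_isHomogeneous d u, ?_⟩
  have := homogeneousComponent_mem_varPowerIdeal (k + d) hu
  rwa [map_sub, homogeneousComponent_sumX_pow_mul, homogeneousComponent_eq_self hf] at this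

lemma eq_zero_of_mem_fourPowerIdeal {k d : ℕ} (hd : d < k) {f : MvPolynomial (Fin 3) K}
    (hf : f.IsHomogeneous d) (h : f ∈ fourPowerIdeal K k) : f = 0 := by
  obtain ⟨u, hu⟩ := mem_fourPowerIdeal.1 h
  have := homogeneousComponent_mem_varPowerIdeal d hu
  rw [map_sub, homogeneousComponent_sumX_pow_mul_of_lt hd, homogeneousComponent_eq_self hf,
    sub_zero] at this
  exact eq_zero_of_isHomogeneous_of_mem hd hf this

lemma exists_isHomogeneous_notMem_fourPowerIdeal (K : Type*) [Field K] (n : ℕ) :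
    ∃ f : MvPolynomial (Fin 3) K, f.IsHomogeneous (2 * n + 2) ∧ f ∉ fourPowerIdeal K (n + 2) := by
  by_contra! hall
  have hle : quotientComponent (varPowerIdeal K (n + 2)) (2 * n + 2) ≤
      (quotientComponent (varPowerIdeal K (n + 2)) n).map (mulSumXPow K (n + 2) (n + 2)) := by
    rintro _ ⟨f, hf, rfl⟩
    obtain ⟨u, hu, h⟩ := exists_isHomogeneous_of_mem_fourPowerIdeal (k := n + 2) (d := n)
      (by rwa [show n + 2 + n = 2 * n + 2 by ring]) (hall f hf)
    refine ⟨_, ⟨u, hu, rfl⟩, (mulSumXPow_mk _ _ _).trans ?_⟩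
    exact (Ideal.Quotient.eq.2 h).symm
  have h1 := (Submodule.finrank_mono hle).trans (Submodule.finrank_map_le _ _)
  rw [finrank_quotientComponent_varPowerIdeal, finrank_quotientComponent_varPowerIdeal,
    ncard_boxExponents_compl (e := n + 1) (by omega)] at h1
  exact absurd (ncard_boxExponents_lt n) (by omega)

/-- The socle of `K[x, y, z] / (x ^ k, y ^ k, z ^ k)` is spanned by `(x y z) ^ (k - 1)`, which lies
in `(x ^ k, y ^ k, z ^ k, (x + y + z) ^ k)` for degree reasons. -/
lemma mem_fourPowerIdeal_of_X_mul_mem_varPowerIdeal {n : ℕ}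
    (hK : ∀ j : ℕ, 0 < j → j ≤ 3 * (n + 2) - 3 → (j : K) ≠ 0) {f : MvPolynomial (Fin 3) K}
    (hf : ∀ j, X j * f ∈ varPowerIdeal K (n + 2)) : f ∈ fourPowerIdeal K (n + 2) := by
  rw [f.as_sum]
  refine Ideal.sum_mem _ fun m hm => ?_
  by_cases hb : ∃ j, n + 2 ≤ m j
  · refine (le_sup_right : varPowerIdeal K (n + 2) ≤ _) (mem_varPowerIdeal.2 fun m' hm' => ?_)
    rwa [Finset.mem_singleton.1 (support_monomial_subset hm')]
  · push Not at hb
    -- Multiplying by `X j` raises only the `j`-th exponent, so that exponent must be the one that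
    -- reaches `k`.
    have hm1 : ∀ j, m j = n + 1 := by
      intro j
      obtain ⟨i, hi⟩ := mem_varPowerIdeal.1 (hf j) (Finsupp.single j 1 + m) (by
        rw [mem_support_iff, coeff_X_mul]
        exact mem_support_iff.1 hm)
      have hbi := hb i
      rw [Finsupp.add_apply, Finsupp.single_apply] at hi
      split_ifs at hi with hji
      · subst hji
        omega
      · omega
    refine mem_fourPowerIdeal_of_isHomogeneous_of_le hK (d := 3 * n + 3) (by omega)
      (isHomogeneous_monomial _ ?_)
    rw [degree_fin_three, hm1, hm1, hm1]
    ring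

lemma mem_fourPowerIdeal_of_X_mul_mem {n d : ℕ}
    (hK : ∀ j : ℕ, 0 < j → j ≤ 3 * (n + 2) - 3 → (j : K) ≠ 0) (hd : d ≤ 2 * n)
    {f : MvPolynomial (Fin 3) K} (hf : f.IsHomogeneous d)
    (h : ∀ j, X j * f ∈ fourPowerIdeal K (n + 2)) : f ∈ fourPowerIdeal K (n + 2) := by
  have hXf : ∀ j, (X j * f).IsHomogeneous (d + 1) := fun j => by
    simpa [add_comm] using (isHomogeneous_X K j).mul hf
  rcases lt_or_ge (d + 1) (n + 2) with hlt | hge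
  · have := eq_zero_of_mem_fourPowerIdeal hlt (hXf 0) (h 0)
    rw [(mul_eq_zero.1 this).resolve_left (X_ne_zero 0)]
    exact Ideal.zero_mem _
  obtain ⟨t, ht⟩ := Nat.exists_eq_add_of_le hge
  choose u hu hfu using fun j =>
    exists_isHomogeneous_of_mem_fourPowerIdeal (ht ▸ hXf j) (h j)
  have hX : ∀ i j, (X i * u j).IsHomogeneous (t + 1) := fun i j => by
    simpa [add_comm] using (isHomogeneous_X K i).mul (hu j)
  have key : ∀ i j, X i * u j = X j * u i := by
    intro i j
    rw [← sub_eq_zero]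
    refine eq_zero_of_isHomogeneous_of_mem (k := n + 2) (d := t + 1) (by omega)
      ((hX i j).sub (hX j i)) ?_
    have hmem : sumX K ^ (n + 2) * (X i * u j - X j * u i) ∈ varPowerIdeal K (n + 2) := by
      convert Ideal.sub_mem _ (Ideal.mul_mem_left _ (X j) (hfu i))
        (Ideal.mul_mem_left _ (X i) (hfu j)) using 1
      ring
    -- Since `d ≤ 2n` gives `t + 1 ≤ n`, the Lefschetz exponent is at least `n + 3`, so it exceeds
    -- `k`. In degree `d = 2k - 3` it would be only `k - 1`.
    refine mem_varPowerIdeal_of_sumX_pow_mul_mem (i := t + 1) (n := 3 * (n + 2) - 3 - 2 * (t + 1))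
      (by omega) hK (by omega) ((hX i j).sub (hX j i)) ?_
    exact Ideal.mem_of_dvd _ (mul_dvd_mul_right (pow_dvd_pow _ (by omega)) _) hmem
  obtain ⟨v, hv⟩ : (X 0 : MvPolynomial (Fin 3) K) ∣ u 0 := by
    have hdvd : (X 0 : MvPolynomial (Fin 3) K) ∣ X 1 * u 0 := ⟨u 1, key 1 0⟩
    refine (X_prime (R := K) (i := (0 : Fin 3))).dvd_or_dvd hdvd |>.resolve_left ?_
    simp [X_dvd_X]
  have hv' : ∀ j, u j = X j * v := by
    intro j
    refine mul_left_cancel₀ (X_ne_zero (R := K) (0 : Fin 3)) ?_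
    rw [key 0 j, hv]
    ring
  have hw : f - sumX K ^ (n + 2) * v ∈ fourPowerIdeal K (n + 2) := by
    refine mem_fourPowerIdeal_of_X_mul_mem_varPowerIdeal hK fun j => ?_
    convert hfu j using 1
    rw [hv']
    ring
  refine (Submodule.sub_mem_iff_left _ (Ideal.mul_mem_right _ _ ?_)).1 hw
  exact (le_sup_left : Ideal.span {sumX K ^ (n + 2)} ≤ _) (Ideal.mem_span_singleton_self _)

end
end

/-! ### Change of coordinates and genericity -/

noncomputable section

/-- The linear substitution sending the `j`-th variable to the linear form with coefficients the
`j`-th row of `B`. -/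
def linSubst {K : Type*} [Field K] (B : Matrix (Fin 3) (Fin 3) K) :
    MvPolynomial (Fin 3) K →ₐ[K] MvPolynomial (Fin 3) K :=
  aeval fun j => linForm (B j)

section

open Matrix

variable {K : Type*} [Field K]

lemma isHomogeneous_linForm (a : Fin 3 → K) : (linForm a).IsHomogeneous 1 :=
  IsHomogeneous.sum _ _ _ fun j _ => isHomogeneous_C_mul_X (a j) j

lemma linForm_smul (c : K) (a : Fin 3 → K) : linForm (c • a) = C c * linForm a := by
  simp [linForm, Finset.mul_sum, mul_assoc]

lemma linForm_sum {ι : Type*} (s : Finset ι) (a : ι → Fin 3 → K) :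
    linForm (∑ i ∈ s, a i) = ∑ i ∈ s, linForm (a i) := by
  simp only [linForm, Finset.sum_apply, map_sum, Finset.sum_mul]
  exact Finset.sum_comm

lemma linForm_one_row (j : Fin 3) : linForm ((1 : Matrix (Fin 3) (Fin 3) K) j) = X j := by
  simp [linForm, Matrix.one_apply]

lemma linSubst_X (B : Matrix (Fin 3) (Fin 3) K) (j : Fin 3) : linSubst B (X j) = linForm (B j) :=
  aeval_X _ _

lemma linSubst_linForm (B : Matrix (Fin 3) (Fin 3) K) (v : Fin 3 → K) :
    linSubst B (linForm v) = linForm (v ᵥ* B) := by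
  have h : v ᵥ* B = ∑ j, v j • B j := by
    ext i
    simp [vecMul, dotProduct]
  rw [h, linForm_sum, linForm, map_sum]
  refine Finset.sum_congr rfl fun j _ => ?_
  rw [map_mul, linSubst_X, linForm_smul, ← algebraMap_eq, AlgHom.commutes]

/-- Substitutions act on coefficient rows by right multiplication, so composition reverses the
matrix product. -/
lemma linSubst_comp (B B' : Matrix (Fin 3) (Fin 3) K) (h : B' * B = 1) :
    (linSubst B).comp (linSubst B') = AlgHom.id K _ := by
  refine algHom_ext fun j => ?_
  rw [AlgHom.comp_apply, linSubst_X, linSubst_linForm, ← Matrix.mul_apply_eq_vecMul, h,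
    linForm_one_row, AlgHom.id_apply]

lemma isHomogeneous_linSubst (B : Matrix (Fin 3) (Fin 3) K) {d : ℕ} {f : MvPolynomial (Fin 3) K}
    (hf : f.IsHomogeneous d) : (linSubst B f).IsHomogeneous d := by
  rw [← one_mul d]
  exact hf.aeval (fun j => linForm (B j)) fun j => isHomogeneous_linForm (B j)

/-- The socle of `R / I` is nonzero in degree `d`, in terms of representatives. -/
lemma socleComponent_ne_bot_iff {I : Ideal (MvPolynomial (Fin 3) K)} {d : ℕ} :
    socleComponent I d ≠ ⊥ ↔
      ∃ f : MvPolynomial (Fin 3) K, f.IsHomogeneous d ∧ f ∉ I ∧ ∀ j, X j * f ∈ I := by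
  rw [Submodule.ne_bot_iff]
  constructor
  · rintro ⟨_, ⟨hs, f, hf, rfl⟩, h0⟩
    refine ⟨f, hf, fun h => h0 (Ideal.Quotient.eq_zero_iff_mem.2 h), fun j => ?_⟩
    have := hs (X j) (Ideal.subset_span ⟨j, rfl⟩)
    rw [← Ideal.Quotient.eq_zero_iff_mem, map_mul]
    exact this
  · rintro ⟨f, hf, hfI, h⟩
    refine ⟨Ideal.Quotient.mk I f, ⟨fun m hm => ?_, f, hf, rfl⟩,
      fun h0 => hfI (Ideal.Quotient.eq_zero_iff_mem.1 h0)⟩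
    rw [← map_mul, Ideal.Quotient.eq_zero_iff_mem]
    have hle : Ideal.span (Set.range (X : Fin 3 → MvPolynomial (Fin 3) K)) ≤
        Submodule.colon I {f} := by
      rw [Ideal.span_le]
      rintro _ ⟨j, rfl⟩
      exact Submodule.mem_colon_singleton.2 (h j)
    exact Submodule.mem_colon_singleton.1 (hle hm)

lemma socleComponent_ne_bot_of_linSubst {I J : Ideal (MvPolynomial (Fin 3) K)}
    {B B' : Matrix (Fin 3) (Fin 3) K} (h : B * B' = 1) (hI : ∀ f ∈ I, linSubst B f ∈ J)
    (hJ : ∀ f ∈ J, linSubst B' f ∈ I) {d : ℕ} (hd : socleComponent I d ≠ ⊥) :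
    socleComponent J d ≠ ⊥ := by
  have hBB' : ∀ f, linSubst B (linSubst B' f) = f :=
    DFunLike.congr_fun (linSubst_comp B B' (mul_eq_one_comm.1 h))
  have hB'B : ∀ f, linSubst B' (linSubst B f) = f := DFunLike.congr_fun (linSubst_comp B' B h)
  obtain ⟨f, hf, hfI, hX⟩ := socleComponent_ne_bot_iff.1 hd
  refine socleComponent_ne_bot_iff.2 ⟨linSubst B f, isHomogeneous_linSubst B hf,
    fun hm => hfI (hB'B f ▸ hJ _ hm), fun j => ?_⟩
  -- This writes `X j` as the image of a linear form, whose product with `f` lies in `I` because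
  -- each variable times `f` does.
  rw [← hBB' (X j), ← map_mul]
  refine hI _ ?_
  rw [linSubst_X, linForm, Finset.sum_mul]
  refine Ideal.sum_mem _ fun i _ => ?_
  rw [mul_assoc]
  exact Ideal.mul_mem_left _ _ (hX i)

lemma linSubst_mem_of_range {ι : Type*} {g : ι → MvPolynomial (Fin 3) K}
    {J : Ideal (MvPolynomial (Fin 3) K)} {B : Matrix (Fin 3) (Fin 3) K}
    (h : ∀ i, linSubst B (g i) ∈ J) {f : MvPolynomial (Fin 3) K}
    (hf : f ∈ Ideal.span (Set.range g)) : linSubst B f ∈ J := by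
  have : Ideal.span (Set.range g) ≤ J.comap (linSubst B) := by
    rw [Ideal.span_le]
    rintro _ ⟨i, rfl⟩
    exact h i
  exact this hf

/-- Four linear forms in general position become multiples of `x`, `y`, `z`, `x + y + z` after a
linear change of coordinates. -/
lemma socleComponent_uniformPowerIdeal_ne_bot_iff {a : Fin 4 → Fin 3 → K} {c : Fin 3 → K} {e : K}
    (hdet : (Matrix.of fun j : Fin 3 => a j.castSucc).det ≠ 0) (hc : ∀ j, c j ≠ 0) (he : e ≠ 0)
    (h : ∑ j : Fin 3, c j • a j.castSucc = e • a (Fin.last 3)) (k d : ℕ) :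
    socleComponent (uniformPowerIdeal (fun i => linForm (a i)) k) d ≠ ⊥ ↔
      socleComponent (fourPowerIdeal K k) d ≠ ⊥ := by
  -- The rows are scaled by `c` so that they add up to `e • a (Fin.last 3)`; thus `x + y + z` goes
  -- to a multiple of the fourth form.
  let B : Matrix (Fin 3) (Fin 3) K :=
    Matrix.diagonal c * Matrix.of fun j : Fin 3 => a j.castSucc
  have hB : IsUnit B.det := by
    rw [det_mul, det_diagonal, isUnit_iff_ne_zero]
    exact mul_ne_zero (Finset.prod_ne_zero_iff.2 fun j _ => hc j) hdet
  have hBrow : ∀ j, B j = c j • a j.castSucc := fun j => by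
    ext i
    simp [B, diagonal_mul]
  have hX : ∀ j, linSubst B (X j) = C (c j) * linForm (a j.castSucc) := fun j => by
    rw [linSubst_X, hBrow, linForm_smul]
  have hsum : linSubst B (sumX K) = C e * linForm (a (Fin.last 3)) := by
    simp only [sumX, map_sum, linSubst_X, hBrow]
    rw [← linForm_sum, h, linForm_smul]
  have hinv : ∀ f, linSubst B⁻¹ (linSubst B f) = f :=
    DFunLike.congr_fun (linSubst_comp B⁻¹ B (mul_nonsing_inv B hB))
  have hC : ∀ (x : K) f, linSubst B⁻¹ (C x * f) = C x * linSubst B⁻¹ f := fun x f => by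
    rw [map_mul, ← algebraMap_eq, AlgHom.commutes]
  have hcancel : ∀ {x : K} {f g : MvPolynomial (Fin 3) K}, x ≠ 0 → C x * f = g →
      f = C x⁻¹ * g := by
    rintro x f _ hx rfl
    rw [← mul_assoc, ← C_mul, inv_mul_cancel₀ hx, C_1, one_mul]
  have hcast : ∀ j : Fin 3, linSubst B⁻¹ (linForm (a j.castSucc)) = C (c j)⁻¹ * X j := fun j =>
    hcancel (hc j) (by rw [← hC, ← hX, hinv])
  have hlast : linSubst B⁻¹ (linForm (a (Fin.last 3))) = C e⁻¹ * sumX K :=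
    hcancel he (by rw [← hC, ← hsum, hinv])
  have hto : ∀ f ∈ uniformPowerIdeal (fun i => linForm (a i)) k,
      linSubst B⁻¹ f ∈ fourPowerIdeal K k := by
    intro f hf
    refine linSubst_mem_of_range (fun i => ?_) hf
    rw [map_pow]
    refine Fin.lastCases ?_ (fun j => ?_) i
    · rw [hlast, mul_pow]
      exact Ideal.mul_mem_left _ _ (Ideal.mem_sup_left (Ideal.mem_span_singleton_self _))
    · rw [hcast, mul_pow]
      exact Ideal.mul_mem_left _ _ (Ideal.mem_sup_right (Ideal.subset_span ⟨j, rfl⟩))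
  have hmem : ∀ i, linForm (a i) ^ k ∈ uniformPowerIdeal (fun i => linForm (a i)) k :=
    fun i => Ideal.subset_span ⟨i, rfl⟩
  have hfrom : ∀ f ∈ fourPowerIdeal K k,
      linSubst B f ∈ uniformPowerIdeal (fun i => linForm (a i)) k := by
    intro f hf
    obtain ⟨u, hu⟩ := mem_fourPowerIdeal.1 hf
    rw [← sub_add_cancel f (sumX K ^ k * u), map_add, map_mul, map_pow, hsum, mul_pow]
    refine Ideal.add_mem _ (linSubst_mem_of_range (fun j => ?_) hu)
      (Ideal.mul_mem_right _ _ (Ideal.mul_mem_left _ _ (hmem _)))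
    rw [map_pow, hX, mul_pow]
    exact Ideal.mul_mem_left _ _ (hmem _)
  exact ⟨socleComponent_ne_bot_of_linSubst (nonsing_inv_mul B hB) hto hfrom,
    socleComponent_ne_bot_of_linSubst (mul_nonsing_inv B hB) hfrom hto⟩

/-- The product of the four maximal minors of a `4 × 3` matrix, up to signs. -/
def minorsProd {A : Type*} [CommRing A] (a : Fin 4 → Fin 3 → A) : A :=
  (Matrix.of fun j : Fin 3 => a j.castSucc).det *
    ∏ j, (Matrix.of fun j : Fin 3 => a j.castSucc)ᵀ.cramer (a (Fin.last 3)) j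

lemma map_minorsProd {A A' : Type*} [CommRing A] [CommRing A'] (φ : A →+* A')
    (a : Fin 4 → Fin 3 → A) : φ (minorsProd a) = minorsProd fun i j => φ (a i j) := by
  simp only [minorsProd, map_mul, map_prod, cramer_transpose_apply, RingHom.map_det]
  congr! 3 with j
  ext i l
  simp only [RingHom.mapMatrix_apply, map_apply, updateRow_apply]
  split_ifs <;> rfl

/-- The value at `(x, y, z, x + y + z)` shows that the generic product of minors is a nonzero
polynomial. -/
lemma minorsProd_standard :
    minorsProd (Fin.snoc (α := fun _ => Fin 3 → K) (1 : Matrix (Fin 3) (Fin 3) K) 1) = 1 := by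
  change (1 : Matrix (Fin 3) (Fin 3) K).det *
    ∏ j, (1 : Matrix (Fin 3) (Fin 3) K)ᵀ.cramer (1 : Fin 3 → K) j = 1
  simp

lemma socleComponent_fourPowerIdeal_one_ne_bot_iff {d : ℕ} :
    socleComponent (fourPowerIdeal K 1) d ≠ ⊥ ↔ d = 0 := by
  have hX : ∀ j, (X j : MvPolynomial (Fin 3) K) ∈ fourPowerIdeal K 1 := fun j =>
    Ideal.mem_sup_right (Ideal.subset_span ⟨j, pow_one _⟩)
  rw [socleComponent_ne_bot_iff]
  constructor
  · rintro ⟨f, hf, hfI, -⟩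
    by_contra hd
    refine hfI ?_
    rw [f.as_sum]
    refine Ideal.sum_mem _ fun m hm => Ideal.mem_sup_right (mem_varPowerIdeal.2 fun m' hm' => ?_)
    rw [Finset.mem_singleton.1 (support_monomial_subset hm')]
    by_contra! h0
    refine (mem_support_iff.1 hm) (hf.coeff_eq_zero ?_)
    rw [degree_fin_three]
    have := h0 0; have := h0 1; have := h0 2
    omega
  · rintro rfl
    refine ⟨1, isHomogeneous_one _ _, fun h => ?_, fun j => by simpa using hX j⟩
    exact one_ne_zero (eq_zero_of_mem_fourPowerIdeal one_pos (isHomogeneous_one _ _) h)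

/-- The socle degrees of `K[x, y, z] / (x ^ k, y ^ k, z ^ k, (x + y + z) ^ k)`. -/
theorem socleComponent_fourPowerIdeal {k : ℕ} (hk : 1 ≤ k)
    (hK : ∀ j : ℕ, 0 < j → j ≤ 3 * k - 3 → (j : K) ≠ 0) :
    socleComponent (fourPowerIdeal K k) (2 * k - 2) ≠ ⊥ ∧
      ∀ d : ℕ, socleComponent (fourPowerIdeal K k) d ≠ ⊥ → d + 2 = 2 * k ∨ d + 3 = 2 * k := by
  -- For `k = 1` the quotient is `K`, with socle in degree `0`; the other lemmas use `n = k - 2`.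
  obtain rfl | ⟨n, rfl⟩ : k = 1 ∨ ∃ n, k = n + 2 := by
    rcases Nat.eq_or_lt_of_le hk with h | h
    · exact Or.inl h.symm
    · exact Or.inr (Nat.exists_eq_add_of_le' h)
  · simp only [socleComponent_fourPowerIdeal_one_ne_bot_iff]
    exact ⟨trivial, fun d hd => by omega⟩
  refine ⟨?_, fun d hd => ?_⟩
  · obtain ⟨f, hf, hfI⟩ := exists_isHomogeneous_notMem_fourPowerIdeal K n
    refine socleComponent_ne_bot_iff.2 ⟨f, by rwa [show 2 * (n + 2) - 2 = 2 * n + 2 by omega],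
      hfI, fun j => mem_fourPowerIdeal_of_isHomogeneous hK ?_⟩
    have := (isHomogeneous_X K j).mul hf
    rwa [show 1 + (2 * n + 2) = 2 * n + 3 by ring] at this
  · obtain ⟨f, hf, hfI, hX⟩ := socleComponent_ne_bot_iff.1 hd
    by_contra! hne
    rcases le_or_gt d (2 * n) with h | h
    · exact hfI (mem_fourPowerIdeal_of_X_mul_mem hK h hf hX)
    · exact hfI (mem_fourPowerIdeal_of_isHomogeneous_of_le hK (by omega) hf)

end
end

theorem lemma3p3 (K : Type*) [Field K] [Infinite K] :
    ForGeneralLinearForms K 4 (fun L =>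
      ∀ k : ℕ, 1 ≤ k → (ringChar K = 0 ∨ 3 * k - 3 < ringChar K) →
        socleComponent (uniformPowerIdeal L k) (2 * k - 2) ≠ ⊥ ∧
        ∀ d : ℕ, socleComponent (uniformPowerIdeal L k) d ≠ ⊥ → d + 2 = 2 * k ∨ d + 3 = 2 * k) := by
  have heval : ∀ a : Fin 4 → Fin 3 → K, eval (fun ij : Fin 4 × Fin 3 => a ij.1 ij.2)
      (minorsProd fun i j => X (i, j)) = minorsProd a := fun a => by
    simp [map_minorsProd]
  refine ⟨minorsProd fun i j => X (i, j), fun h0 => ?_, fun a ha k hk hchar => ?_⟩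
  · have := heval (Fin.snoc (α := fun _ => Fin 3 → K) (1 : Matrix (Fin 3) (Fin 3) K) 1)
    rw [h0, map_zero, minorsProd_standard] at this
    exact zero_ne_one this
  · rw [heval, minorsProd] at ha
    have hdet := left_ne_zero_of_mul ha
    have hc := fun j => Finset.prod_ne_zero_iff.1 (right_ne_zero_of_mul ha) j (Finset.mem_univ j)
    -- Cramer's rule supplies the relation among the four forms, with minors as coefficients. The
    -- open set is therefore the same for all `k`.
    have hrel := Matrix.mulVec_cramer (Matrix.of fun j : Fin 3 => a j.castSucc).transpose
      (a (Fin.last 3))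
    rw [Matrix.det_transpose, Matrix.mulVec_transpose] at hrel
    have hiff := socleComponent_uniformPowerIdeal_ne_bot_iff hdet hc hdet (by
      rw [← hrel]
      ext i
      simp [Matrix.vecMul, dotProduct]) k
    simp only [hiff]
    refine socleComponent_fourPowerIdeal hk fun j hj hjk h => ?_
    have hdvd := (ringChar.spec K j).1 h
    rcases hchar with h0 | hlt
    · rw [h0, zero_dvd_iff] at hdvd
      omega
    · exact absurd (Nat.le_of_dvd hj hdvd) (by omega)
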